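/- Let $d\ge 2$ be an integer. For $b,k\in\mathbb N=\{1,2,\dots\}$ and $i\in\{1,\dots,b\}$ let $h_{b,i}(x)=b\,\mathbf 1\{(i-1)/b\le x<i/b\}$ on $[0,1)$, let $\mathcal H_{1,b}=\operatorname{Conv}\{h_{b,1},\dots,h_{b,b}\}$, and let $$\mathcal H_{d,b}^k=\Big\{(x_1,\dots,x_d)\mapsto\sum_{i=1}^k w_i\prod_{j=1}^d p_{i,j}(x_j)\ :\ w_i\ge 0,\ \sum_{i=1}^k w_i=1,\ p_{i,j}\in\mathcal H_{1,b}\Big\}.$$ Let $\mathcal D_d$ be the set of all probability densities on $[0,1)^d$ with respect to Lebesgue measure, and let $\|\cdot\|_1$ be the $L^1$ norm. **Theorem.** Let $b=b(n)$ and $k=k(n)$ be sequences of positive integers with $b\to\infty$, $k\to\infty$, $b\ge k$ and $n/(bk)\to 0$ as $n\to\infty$. Then there is no sequence of estimators $V_n=V_n(X_1,\dots,X_n)\in\mathcal H_{d,b}^k$, that is, of functions of $X_1,\dots,X_n\overset{iid}{\sim}p$ with values in $\mathcal H_{d,b}^k$, such that for all $\varepsilon>0$ $$\sup_{p\in\mathcal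 D_d}P\Big(\|V_n-p\|_1>3\min_{q\in\mathcal H_{d,b}^k}\|p-q\|_1+\varepsilon\Big)\longrightarrow 0\qquad(n\to\infty).$$ Here $V_n$ is not required to be measurable; for a non-measurable event, $P$ denotes outer probability. -/

import Mathlib

open MeasureTheory Filter Topology
open scoped ENNReal

noncomputable section

/-- The half-open unit cube `[0,1)^d`. -/
def unitCube (d : ℕ) : Set (Fin d → ℝ) := Set.univ.pi fun _ => Set.Ico 0 1

/-- Probability densities on `[0,1)^d` with respect to Lebesgue measure, as functions on `ℝ^d`
that vanish outside the cube. -/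
structure IsCubeDensity (d : ℕ) (p : (Fin d → ℝ) → ℝ) : Prop where
  measurable : Measurable p
  nonneg : ∀ x, 0 ≤ p x
  eq_zero_of_notMem : ∀ x, x ∉ unitCube d → p x = 0
  lintegral_eq_one : ∫⁻ x, ENNReal.ofReal (p x) = 1

/-- The probability measure on `ℝ^d` with density `p`. -/
def densityMeasure {d : ℕ} (p : (Fin d → ℝ) → ℝ) : Measure (Fin d → ℝ) :=
  volume.withDensity fun x => ENNReal.ofReal (p x)

/-- The joint law of `n` independent samples from the density `p`. -/
def sampleLaw {d : ℕ} (n : ℕ) (p : (Fin d → ℝ) → ℝ) : Measure (Fin n → Fin d → ℝ) :=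
  Measure.pi fun _ => densityMeasure p

/-- The one-dimensional histogram with `b` bins whose whole weight is on one bin. The bins are
numbered from `0`, so bin `i` is `[i/b, (i+1)/b)`. -/
def binHistogram (b : ℕ) (i : Fin b) : ℝ → ℝ :=
  (Set.Ico ((i : ℝ) / b) (((i : ℝ) + 1) / b)).indicator fun _ => (b : ℝ)

/-- The set of one-dimensional histograms with `b` bins. -/
def histograms (b : ℕ) : Set (ℝ → ℝ) := convexHull ℝ (Set.range (binHistogram b))

/-- Multi-view histograms on `[0,1)^d`: mixtures of `k` products of `d` one-dimensional histograms
with `b` bins. -/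
def multiViewHistograms (d b k : ℕ) : Set ((Fin d → ℝ) → ℝ) :=
  {q | ∃ w ∈ stdSimplex ℝ (Fin k), ∃ f : Fin k → Fin d → ℝ → ℝ,
    (∀ i j, f i j ∈ histograms b) ∧ q = fun x => ∑ i, w i * ∏ j, f i j (x j)}

/-- The `L¹` distance with respect to Lebesgue measure. -/
def l1Dist {d : ℕ} (f g : (Fin d → ℝ) → ℝ) : ℝ≥0∞ := eLpNorm (f - g) 1 volume

/-- The approximation error `min_q ‖p - q‖₁` of `p` over the multi-view histograms. -/
def approxError (d b k : ℕ) (p : (Fin d → ℝ) → ℝ) : ℝ≥0∞ :=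
  ⨅ q ∈ multiViewHistograms d b k, l1Dist p q

end

/-! The class `multiViewHistograms` itself is too rich to be learned from o(bk) samples, so
densities with zero approximation error already suffice. Choose `k` rows of cells, which takes `k ≤
b` and a second direction, and cut each row into `b / 2` adjacent pairs. Selecting one cell from
each pair gives a uniform density in the class (`selectedDensity_rowPairs_mem_multiViewHistograms`).
If `8 * n ≤ b * k`, the sample misses at least half of the pairs; switching the selection there
keeps the likelihood but moves the density far in L¹ (`lt_l1Dist_or_lt_l1Dist_switchUnobserved`).
Averaging over all selections, any estimator fails with outer probability at least 1/2 for one of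
them (`exists_half_le_sampleLaw`). -/

open Finset in
/-- If the involution `τ` preserves the index set of a family at every point, and if every point of
`R s` lies in `E s` or in `E (τ s)`, then at least half of the indices of the point are caught. -/
lemma sum_indicator_le_two_mul {Ω S : Type*} [Fintype S] {R E : S → Set Ω} {x : Ω} {τ : S → S}
    (hτ : Function.Involutive τ) (h : ∀ s, x ∈ R s → x ∈ E s ∨ x ∈ E (τ s)) :
    ∑ s, (R s).indicator (1 : Ω → ℝ≥0∞) x ≤ 2 * ∑ s, (E s).indicator (1 : Ω → ℝ≥0∞) x := by
  have hsum : ∑ s, (E (τ s)).indicator (1 : Ω → ℝ≥0∞) x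
      = ∑ s, (E s).indicator (1 : Ω → ℝ≥0∞) x :=
    Equiv.sum_comp hτ.toPerm fun s => (E s).indicator (1 : Ω → ℝ≥0∞) x
  rw [two_mul]
  nth_rewrite 2 [← hsum]
  rw [← sum_add_distrib]
  refine sum_le_sum fun s _ => ?_
  by_cases hx : x ∈ R s
  · rw [Set.indicator_of_mem hx]
    rcases h s hx with h1 | h1
    · rw [Set.indicator_of_mem h1]; exact le_self_add
    · rw [Set.indicator_of_mem h1]; exact le_add_self
  · rw [Set.indicator_of_notMem hx]; exact zero_le

/-! ### Grid cells -/

section Box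

variable {d b : ℕ}

/-- The cell of the regular grid of mesh `1/b` with multi-index `β`. -/
def gridCell (β : Fin d → Fin b) : Set (Fin d → ℝ) :=
  Set.univ.pi fun j => Set.Ico ((β j : ℝ) / b) (((β j : ℝ) + 1) / b)

lemma measurableSet_gridCell (β : Fin d → Fin b) : MeasurableSet (gridCell β) :=
  MeasurableSet.univ_pi fun _ => measurableSet_Ico

lemma volume_gridCell (β : Fin d → Fin b) :
    volume (gridCell β) = ENNReal.ofReal ((1 / b : ℝ) ^ d) := by
  rw [gridCell, Real.volume_pi_Ico]
  simp only [← sub_div, add_sub_cancel_left]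
  rw [Finset.prod_const, Finset.card_univ, Fintype.card_fin, ENNReal.ofReal_pow (by positivity)]

lemma gridCell_subset_unitCube (β : Fin d → Fin b) : gridCell β ⊆ unitCube d := by
  intro x hx j hj
  have hb : (0 : ℝ) < b := by exact_mod_cast (Nat.zero_le _).trans_lt (β j).isLt
  obtain ⟨h1, h2⟩ := hx j hj
  refine ⟨le_trans (by positivity) h1, h2.trans_le ?_⟩
  rw [div_le_one hb]
  exact_mod_cast (β j).isLt

lemma eq_of_mem_Ico_div {i i' : Fin b} {x : ℝ}
    (h : x ∈ Set.Ico ((i : ℝ) / b) (((i : ℝ) + 1) / b))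
    (h' : x ∈ Set.Ico ((i' : ℝ) / b) (((i' : ℝ) + 1) / b)) : i = i' := by
  have hb : (0 : ℝ) < b := by exact_mod_cast (Nat.zero_le _).trans_lt i.isLt
  have h1 := (div_lt_div_iff_of_pos_right hb).1 (h.1.trans_lt h'.2)
  have h2 := (div_lt_div_iff_of_pos_right hb).1 (h'.1.trans_lt h.2)
  have h3 : (i : ℕ) < i' + 1 := by exact_mod_cast h1
  have h4 : (i' : ℕ) < i + 1 := by exact_mod_cast h2
  exact Fin.ext (by omega)

lemma eq_of_mem_gridCell {β β' : Fin d → Fin b} {x : Fin d → ℝ}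
    (h : x ∈ gridCell β) (h' : x ∈ gridCell β') : β = β' :=
  funext fun j => eq_of_mem_Ico_div (h j trivial) (h' j trivial)

lemma prod_binHistogram (β : Fin d → Fin b) (x : Fin d → ℝ) :
    ∏ j, binHistogram b (β j) (x j) = (gridCell β).indicator (fun _ => (b : ℝ) ^ d) x := by
  by_cases hx : x ∈ gridCell β
  · rw [Set.indicator_of_mem hx]
    have h : ∀ j ∈ Finset.univ, binHistogram b (β j) (x j) = b := fun j _ =>
      Set.indicator_of_mem (hx j trivial) _
    rw [Finset.prod_congr rfl h, Finset.prod_const, Finset.card_univ, Fintype.card_fin]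
  · rw [Set.indicator_of_notMem hx]
    simp only [gridCell, Set.mem_univ_pi, not_forall] at hx
    obtain ⟨j, hj⟩ := hx
    exact Finset.prod_eq_zero (Finset.mem_univ j) (Set.indicator_of_notMem hj _)

end Box

lemma measurable_of_mem_histograms {b : ℕ} {f : ℝ → ℝ} (hf : f ∈ histograms b) :
    Measurable f := by
  have hconv : Convex ℝ {g : ℝ → ℝ | Measurable g} := fun g hg h hh s t _ _ _ =>
    (hg.const_smul s).add (hh.const_smul t)
  refine convexHull_min ?_ hconv hf
  rintro _ ⟨i, rfl⟩
  exact measurable_const.indicator measurableSet_Ico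

/-- Serves the triangle inequality in L¹: each value of the estimator is measurable, while its
dependence on the sample stays arbitrary. -/
lemma measurable_of_mem_multiViewHistograms {d b k : ℕ} {q : (Fin d → ℝ) → ℝ}
    (hq : q ∈ multiViewHistograms d b k) : Measurable q := by
  obtain ⟨w, -, f, hf, rfl⟩ := hq
  exact Finset.measurable_sum _ fun i _ => (Finset.measurable_prod _ fun j _ =>
    (measurable_of_mem_histograms (hf i j)).comp (measurable_pi_apply j)).const_mul _

/-! ### Lower bound for selections from pairs of cells -/

section Selection

variable {d b : ℕ} {ι : Type*} (φ : ι → Bool → Fin d → Fin b)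

/-- The union of the grid cells that `s` selects, one out of each of the pairs `φ c`. -/
def selectedRegion (s : ι → Bool) : Set (Fin d → ℝ) := ⋃ c, gridCell (φ c (s c))

/-- The uniform density on `selectedRegion φ s`. -/
noncomputable def selectedDensity [Fintype ι] (s : ι → Bool) : (Fin d → ℝ) → ℝ :=
  (selectedRegion φ s).indicator fun _ => (b : ℝ) ^ d / Fintype.card ι

/-- Lebesgue measure, scaled so that each `selectedRegion φ s` has mass one. -/
noncomputable def scaledVolume (d b : ℕ) (ι : Type*) [Fintype ι] : Measure (Fin d → ℝ) :=
  ENNReal.ofReal ((b : ℝ) ^ d / Fintype.card ι) • volume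

instance [Fintype ι] : SigmaFinite (scaledVolume d b ι) := by
  rw [scaledVolume, ← withDensity_const]
  exact SigmaFinite.withDensity_of_ne_top (by simp)

lemma measurableSet_selectedRegion [Countable ι] (s : ι → Bool) :
    MeasurableSet (selectedRegion φ s) :=
  MeasurableSet.iUnion fun _ => measurableSet_gridCell _

lemma measurable_selectedDensity [Fintype ι] (s : ι → Bool) :
    Measurable (selectedDensity φ s) :=
  measurable_const.indicator (measurableSet_selectedRegion φ s)

lemma densityMeasure_selectedDensity [Fintype ι] (s : ι → Bool) :
    densityMeasure (selectedDensity φ s)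
      = (scaledVolume d b ι).restrict (selectedRegion φ s) := by
  have h : (fun x => ENNReal.ofReal (selectedDensity φ s x)) = (selectedRegion φ s).indicator
      fun _ => ENNReal.ofReal ((b : ℝ) ^ d / Fintype.card ι) := by
    funext x
    by_cases hx : x ∈ selectedRegion φ s <;> simp [selectedDensity, hx]
  rw [densityMeasure, h, withDensity_indicator (measurableSet_selectedRegion φ s),
    withDensity_const, scaledVolume, Measure.restrict_smul]

/-- All the laws are restrictions of one product measure, so likelihoods are indicators and can be
summed over `s` under a single integral. -/
lemma sampleLaw_selectedDensity [Fintype ι] (n : ℕ) (s : ι → Bool) :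
    sampleLaw n (selectedDensity φ s) = (Measure.pi fun _ => scaledVolume d b ι).restrict
      (Set.univ.pi fun _ : Fin n => selectedRegion φ s) := by
  rw [sampleLaw, densityMeasure_selectedDensity, Measure.restrict_pi_pi]

variable {φ}

lemma scaledVolume_biUnion_gridCell [Fintype ι] (hb : b ≠ 0)
    (hφ : Function.Injective (Function.uncurry φ)) (s : ι → Bool) (U : Finset ι) :
    scaledVolume d b ι (⋃ c ∈ U, gridCell (φ c (s c)))
      = ENNReal.ofReal ((U.card : ℝ) / Fintype.card ι) := by
  have hdisj : Set.PairwiseDisjoint (U : Set ι) fun c => gridCell (φ c (s c)) := by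
    intro c _ c' _ hne
    refine Set.disjoint_left.2 fun x h h' => hne ?_
    have := @hφ (c, s c) (c', s c') (eq_of_mem_gridCell h h')
    exact congrArg Prod.fst this
  rw [scaledVolume, Measure.smul_apply, measure_biUnion_finset hdisj
    fun _ _ => measurableSet_gridCell _]
  simp only [volume_gridCell]
  rw [Finset.sum_const, smul_eq_mul, nsmul_eq_mul, ← ENNReal.ofReal_natCast,
    ← ENNReal.ofReal_mul (by positivity), ← ENNReal.ofReal_mul (by positivity)]
  congr 1
  have : (b : ℝ) ≠ 0 := by exact_mod_cast hb
  rw [one_div, inv_pow]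
  field_simp

lemma scaledVolume_selectedRegion [Fintype ι] [Nonempty ι] (hb : b ≠ 0)
    (hφ : Function.Injective (Function.uncurry φ)) (s : ι → Bool) :
    scaledVolume d b ι (selectedRegion φ s) = 1 := by
  have h := scaledVolume_biUnion_gridCell hb hφ s Finset.univ
  simp only [Finset.mem_univ, Set.iUnion_true] at h
  rw [selectedRegion, h, Finset.card_univ, div_self (by simp), ENNReal.ofReal_one]

lemma isCubeDensity_selectedDensity [Fintype ι] [Nonempty ι] (hb : b ≠ 0)
    (hφ : Function.Injective (Function.uncurry φ)) (s : ι → Bool) :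
    IsCubeDensity d (selectedDensity φ s) where
  measurable := measurable_selectedDensity φ s
  nonneg x := Set.indicator_nonneg (fun _ _ => by positivity) x
  eq_zero_of_notMem x hx := Set.indicator_of_notMem
    (fun h => hx (Set.iUnion_subset (fun _ => gridCell_subset_unitCube _) h)) _
  lintegral_eq_one := by
    have h := congrArg (fun μ => μ Set.univ) (densityMeasure_selectedDensity φ s)
    simpa [densityMeasure, withDensity_apply, scaledVolume_selectedRegion hb hφ s] using h

/-- Densities whose selections differ on `U` are at distance at least `#U / #ι`. -/
lemma le_l1Dist_selectedDensity [Fintype ι] (hb : b ≠ 0)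
    (hφ : Function.Injective (Function.uncurry φ)) {s t : ι → Bool} {U : Finset ι}
    (hU : ∀ c ∈ U, s c ≠ t c) :
    ENNReal.ofReal ((U.card : ℝ) / Fintype.card ι)
      ≤ l1Dist (selectedDensity φ s) (selectedDensity φ t) := by
  rw [← scaledVolume_biUnion_gridCell hb hφ s U, scaledVolume, Measure.smul_apply, smul_eq_mul,
    l1Dist, eLpNorm_one_eq_lintegral_enorm, ← setLIntegral_const]
  -- On these cells the density of `t` vanishes. The cells selected by `t` would double the bound,
  -- which is not needed.
  refine (setLIntegral_mono' (Finset.measurableSet_biUnion _ fun _ _ => measurableSet_gridCell _)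
    fun x hx => ?_).trans (setLIntegral_le_lintegral _ _)
  simp only [Set.mem_iUnion] at hx
  obtain ⟨c, hc, hx⟩ := hx
  have h1 : x ∈ selectedRegion φ s := Set.mem_iUnion.2 ⟨c, hx⟩
  have h2 : x ∉ selectedRegion φ t := by
    intro h
    obtain ⟨c', hx'⟩ := Set.mem_iUnion.1 h
    have := @hφ (c, s c) (c', t c') (eq_of_mem_gridCell hx hx')
    obtain ⟨rfl, h3⟩ := Prod.mk.inj this
    exact hU c hc h3
  rw [Pi.sub_apply, selectedDensity, selectedDensity, Set.indicator_of_mem h1,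
    Set.indicator_of_notMem h2, sub_zero, Real.enorm_of_nonneg (by positivity)]

open Classical in
/-- The pairs of cells in which none of the points `X i` lies. -/
noncomputable def unobserved [Fintype ι] (φ : ι → Bool → Fin d → Fin b) {n : ℕ}
    (X : Fin n → Fin d → ℝ) : Finset ι :=
  Finset.univ.filter fun c => ∀ i a, X i ∉ gridCell (φ c a)

/-- The cells of all the pairs are disjoint, so each sample point meets at most one pair. -/
lemma card_le_card_unobserved_add [Fintype ι] (hφ : Function.Injective (Function.uncurry φ))
    {n : ℕ} (X : Fin n → Fin d → ℝ) : Fintype.card ι ≤ (unobserved φ X).card + n := by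
  classical
  have hsub : (unobserved φ X)ᶜ ⊆ Finset.univ.biUnion fun i =>
      Finset.univ.filter fun c => ∃ a, X i ∈ gridCell (φ c a) := by
    intro c hc
    rw [Finset.mem_compl, unobserved, Finset.mem_filter] at hc
    push Not at hc
    simpa only [Finset.mem_biUnion, Finset.mem_filter, Finset.mem_univ, true_and] using
      hc (Finset.mem_univ c)
  have hcard := (Finset.card_le_card hsub).trans (Finset.card_biUnion_le_card_mul _ _ 1 ?_)
  · rw [Finset.card_compl, Finset.card_univ, Fintype.card_fin, mul_one] at hcard
    omega
  · intro i _
    refine Finset.card_le_one.2 fun c hc c' hc' => ?_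
    obtain ⟨a, ha⟩ := (Finset.mem_filter.1 hc).2
    obtain ⟨a', ha'⟩ := (Finset.mem_filter.1 hc').2
    have := @hφ (c, a) (c', a') (eq_of_mem_gridCell ha ha')
    exact congrArg Prod.fst this

open Classical in
/-- The selection `s` switched at all the unobserved pairs. -/
noncomputable def switchUnobserved [Fintype ι] (φ : ι → Bool → Fin d → Fin b) {n : ℕ}
    (X : Fin n → Fin d → ℝ) (s : ι → Bool) : ι → Bool :=
  fun c => if c ∈ unobserved φ X then !s c else s c

/-- The set `unobserved φ X` depends on the sample only, not on `s`. -/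
lemma switchUnobserved_involutive [Fintype ι] {n : ℕ} (X : Fin n → Fin d → ℝ) :
    Function.Involutive (switchUnobserved φ X) := by
  intro s
  funext c
  by_cases hc : c ∈ unobserved φ X <;> simp [switchUnobserved, hc]

lemma mem_selectedRegion_switchUnobserved [Fintype ι] {n : ℕ} {X : Fin n → Fin d → ℝ}
    {s : ι → Bool} {i : Fin n} (h : X i ∈ selectedRegion φ s) :
    X i ∈ selectedRegion φ (switchUnobserved φ X s) := by
  obtain ⟨c, hc⟩ := Set.mem_iUnion.1 h
  have hobs : c ∉ unobserved φ X := fun hmem => by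
    classical
    exact (Finset.mem_filter.1 hmem).2 i _ hc
  refine Set.mem_iUnion.2 ⟨c, ?_⟩
  rwa [switchUnobserved, if_neg hobs]

/-- The densities of the selections `s` and `switchUnobserved φ X s` explain the sample `X` equally
well, and no function is close to both. -/
lemma lt_l1Dist_or_lt_l1Dist_switchUnobserved [Fintype ι] [Nonempty ι] (hb : b ≠ 0)
    (hφ : Function.Injective (Function.uncurry φ)) {n : ℕ} (hn : 2 * n ≤ Fintype.card ι)
    (X : Fin n → Fin d → ℝ) {v : (Fin d → ℝ) → ℝ} (hv : Measurable v) (s : ι → Bool) :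
    ENNReal.ofReal (1 / 8) < l1Dist v (selectedDensity φ s) ∨
      ENNReal.ofReal (1 / 8) < l1Dist v (selectedDensity φ (switchUnobserved φ X s)) := by
  by_contra! hcon
  obtain ⟨h1, h2⟩ := hcon
  have hdiff : ∀ c ∈ unobserved φ X, s c ≠ switchUnobserved φ X s c := by
    intro c hc
    simp [switchUnobserved, hc]
  have hsep := le_l1Dist_selectedDensity hb hφ hdiff
  set p := selectedDensity φ s
  set q := selectedDensity φ (switchUnobserved φ X s)
  have hp : Measurable p := measurable_selectedDensity φ _
  have hq : Measurable q := measurable_selectedDensity φ _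
  have htri : l1Dist p q ≤ l1Dist v p + l1Dist v q := by
    have h := eLpNorm_sub_le (μ := volume) (p := 1) (hv.sub hq).aestronglyMeasurable
      (hv.sub hp).aestronglyMeasurable le_rfl
    rw [sub_sub_sub_cancel_left] at h
    rwa [add_comm]
  -- Two errors of at most 1/8 add up to 1/4, but at least half of the pairs are unobserved, so the
  -- separation is at least 1/2.
  have hle := hsep.trans (htri.trans (add_le_add h1 h2))
  rw [← ENNReal.ofReal_add (by norm_num) (by norm_num),
    ENNReal.ofReal_le_ofReal_iff (by norm_num)] at hle
  have hpos : (0 : ℝ) < Fintype.card ι := by exact_mod_cast Fintype.card_pos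
  have hcard : (Fintype.card ι : ℝ) ≤ (unobserved φ X).card + n := by
    exact_mod_cast card_le_card_unobserved_add hφ X
  have hn' : 2 * (n : ℝ) ≤ Fintype.card ι := by exact_mod_cast hn
  rw [div_le_iff₀ hpos] at hle
  linarith

/-- With at most half as many samples as pairs of cells, every estimator fails with outer
probability at least `1/2` for one of the densities `selectedDensity φ s`. -/
lemma exists_half_le_sampleLaw [Fintype ι] [Nonempty ι] (hb : b ≠ 0)
    (hφ : Function.Injective (Function.uncurry φ)) {n : ℕ} (hn : 2 * n ≤ Fintype.card ι)
    {W : (Fin n → Fin d → ℝ) → (Fin d → ℝ) → ℝ} (hW : ∀ X, Measurable (W X)) :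
    ∃ s : ι → Bool, 2⁻¹ ≤ sampleLaw n (selectedDensity φ s)
      {X | ENNReal.ofReal (1 / 8) < l1Dist (W X) (selectedDensity φ s)} := by
  classical
  by_contra! hcon
  set A : (ι → Bool) → Set (Fin n → Fin d → ℝ) := fun s =>
    {X | ENNReal.ofReal (1 / 8) < l1Dist (W X) (selectedDensity φ s)}
  set μ : Measure (Fin n → Fin d → ℝ) := Measure.pi fun _ => scaledVolume d b ι
  set R : (ι → Bool) → Set (Fin n → Fin d → ℝ) := fun s => Set.univ.pi fun _ => selectedRegion φ s
  have hR : ∀ s, MeasurableSet (R s) := fun s =>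
    MeasurableSet.univ_pi fun _ => measurableSet_selectedRegion φ s
  have hμR : ∀ s, μ (R s) = 1 := fun s => by
    simp [μ, R, Measure.pi_pi, scaledVolume_selectedRegion hb hφ s]
  -- The failure sets `A s` may be non-measurable; measurable hulls keep their outer probabilities
  -- and can be integrated.
  set B : (ι → Bool) → Set (Fin n → Fin d → ℝ) := fun s => toMeasurable (μ.restrict (R s)) (A s)
  have hB : ∀ s, MeasurableSet (B s) := fun s => measurableSet_toMeasurable _ _
  have hμB : ∀ s, μ (B s ∩ R s) < 2⁻¹ := fun s => by
    rw [← Measure.restrict_apply (hB s), measure_toMeasurable, ← sampleLaw_selectedDensity]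
    exact hcon s
  have hpt : ∀ X, ∑ s, (R s).indicator (1 : (Fin n → Fin d → ℝ) → ℝ≥0∞) X
      ≤ 2 * ∑ s, (B s ∩ R s).indicator (1 : (Fin n → Fin d → ℝ) → ℝ≥0∞) X := fun X => by
    refine sum_indicator_le_two_mul (switchUnobserved_involutive (φ := φ) X) fun s hs => ?_
    rcases lt_l1Dist_or_lt_l1Dist_switchUnobserved hb hφ hn X (hW X) s with h | h
    · exact Or.inl ⟨subset_toMeasurable _ _ h, hs⟩
    · exact Or.inr ⟨subset_toMeasurable _ _ h,
        fun i _ => mem_selectedRegion_switchUnobserved (hs i trivial)⟩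
  have hint := lintegral_mono (μ := μ) hpt
  rw [lintegral_const_mul _ (Finset.measurable_sum _ fun s _ =>
      measurable_one.indicator ((hB s).inter (hR s))),
    lintegral_finsetSum _ fun s _ => measurable_one.indicator (hR s),
    lintegral_finsetSum _ fun s _ => measurable_one.indicator ((hB s).inter (hR s))] at hint
  simp only [lintegral_indicator_one (hR _), lintegral_indicator_one ((hB _).inter (hR _)), hμR]
    at hint
  -- If every failure probability were below 1/2, twice their sum would be less than the number of
  -- selections, against `hint`.
  have hlt : ∑ s, μ (B s ∩ R s) < ∑ _s : ι → Bool, (2⁻¹ : ℝ≥0∞) :=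
    ENNReal.sum_lt_sum_of_nonempty Finset.univ_nonempty fun s _ => hμB s
  have hlt2 : 2 * ∑ s, μ (B s ∩ R s) < 2 * ∑ _s : ι → Bool, (2⁻¹ : ℝ≥0∞) :=
    ENNReal.mul_lt_mul_right (by norm_num) (by norm_num) hlt
  rw [Finset.mul_sum _ (fun _ => (2⁻¹ : ℝ≥0∞)),
    ENNReal.mul_inv_cancel (by norm_num) (by norm_num)] at hlt2
  exact absurd hint (not_le.2 hlt2)

/-- `selectedDensity φ s` is the average of the product histograms on the selected cells. -/
lemma selectedDensity_eq_sum [Fintype ι] (hφ : Function.Injective (Function.uncurry φ))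
    (s : ι → Bool) (x : Fin d → ℝ) :
    selectedDensity φ s x
      = (Fintype.card ι : ℝ)⁻¹ * ∑ c, ∏ j, binHistogram b (φ c (s c) j) (x j) := by
  simp only [prod_binHistogram]
  by_cases hx : x ∈ selectedRegion φ s
  · obtain ⟨c, hc⟩ := Set.mem_iUnion.1 hx
    rw [Finset.sum_eq_single c, selectedDensity, Set.indicator_of_mem hx, Set.indicator_of_mem hc,
      div_eq_inv_mul]
    · intro c' _ hne
      refine Set.indicator_of_notMem (fun hc' => hne ?_) _
      have := @hφ (c', s c') (c, s c) (eq_of_mem_gridCell hc' hc)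
      exact congrArg Prod.fst this
    · simp
  · rw [selectedDensity, Set.indicator_of_notMem hx, Finset.sum_eq_zero, mul_zero]
    exact fun c _ => Set.indicator_of_notMem (fun hc => hx (Set.mem_iUnion.2 ⟨c, hc⟩)) _

end Selection

/-! ### Selections along rows as multi-view histograms -/

section Rows

variable {d b k M : ℕ}

/-- The bin `2m` or `2m+1`, according to the second argument. -/
def pairedBin (hM : 2 * M ≤ b) (m : Fin M) (a : Bool) : Fin b :=
  ⟨2 * m + a.toNat, by have := m.isLt; have := a.toNat_le; omega⟩

/-- The pairs of cells that are adjacent in direction `j₁`, in the rows numbered by the bins of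
direction `j₀`; all other indices are zero. -/
def rowPairs (j₀ j₁ : Fin d) (hb : 0 < b) (hkb : k ≤ b) (hM : 2 * M ≤ b) (c : Fin k × Fin M)
    (a : Bool) : Fin d → Fin b :=
  Function.update (Function.update (fun _ => ⟨0, hb⟩) j₀ (Fin.castLE hkb c.1)) j₁
    (pairedBin hM c.2 a)

lemma rowPairs_injective {j₀ j₁ : Fin d} (hj : j₀ ≠ j₁) (hb : 0 < b) (hkb : k ≤ b)
    (hM : 2 * M ≤ b) : Function.Injective (Function.uncurry (rowPairs j₀ j₁ hb hkb hM)) := by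
  rintro ⟨⟨i, m⟩, a⟩ ⟨⟨i', m'⟩, a'⟩ h
  have h0 := congrFun h j₀
  have h1 := congrFun h j₁
  simp only [Function.uncurry, rowPairs, Function.update_of_ne hj, Function.update_self,
    pairedBin, Fin.mk.injEq] at h0 h1
  have hi : i = i' := Fin.castLE_injective hkb h0
  have ha := a.toNat_le
  have ha' := a'.toNat_le
  have hm : m = m' := Fin.ext (by omega)
  have haa : a = a' := by
    rcases a <;> rcases a' <;> simp at h1 ⊢ <;> omega
  rw [hi, hm, haa]

lemma binHistogram_mem_histograms (i : Fin b) : binHistogram b i ∈ histograms b :=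
  subset_convexHull ℝ _ ⟨i, rfl⟩

lemma average_binHistogram_mem_histograms (hM : 0 < M) (β : Fin M → Fin b) :
    (fun t => (M : ℝ)⁻¹ * ∑ m, binHistogram b (β m) t) ∈ histograms b := by
  have h := (convex_convexHull ℝ (Set.range (binHistogram b))).sum_mem (t := Finset.univ)
    (w := fun _ : Fin M => (M : ℝ)⁻¹) (z := fun m => binHistogram b (β m))
    (fun _ _ => by positivity) (by simp [hM.ne']) (fun m _ => binHistogram_mem_histograms (β m))
  have heq : (fun t => (M : ℝ)⁻¹ * ∑ m, binHistogram b (β m) t)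
      = ∑ m, (M : ℝ)⁻¹ • binHistogram b (β m) := by
    funext t
    simp [Finset.sum_apply, Finset.mul_sum]
  rw [heq]
  exact h

/-- The cells selected in one row differ only in direction `j₁`, so their average is a single
product. Hence `k` components describe `k * M` free choices. -/
lemma selectedDensity_rowPairs_mem_multiViewHistograms {j₀ j₁ : Fin d} (hj : j₀ ≠ j₁) (hb : 0 < b)
    (hkb : k ≤ b) (hM : 2 * M ≤ b) (hk : 0 < k) (hM0 : 0 < M) (s : Fin k × Fin M → Bool) :
    selectedDensity (rowPairs j₀ j₁ hb hkb hM) s ∈ multiViewHistograms d b k := by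
  set base : Fin k → Fin d → Fin b := fun i =>
    Function.update (fun _ => ⟨0, hb⟩) j₀ (Fin.castLE hkb i)
  set β : Fin k → Fin M → Fin b := fun i m => pairedBin hM m (s (i, m)) with hβ
  refine ⟨fun _ => (k : ℝ)⁻¹, ⟨fun _ => by positivity, by simp [hk.ne']⟩,
    fun i => Function.update (fun j => binHistogram b (base i j)) j₁
      (fun t => (M : ℝ)⁻¹ * ∑ m, binHistogram b (β i m) t), fun i j => ?_, ?_⟩
  · beta_reduce
    by_cases h : j = j₁
    · subst h
      rw [Function.update_self]
      exact average_binHistogram_mem_histograms hM0 _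
    · rw [Function.update_of_ne h]
      exact binHistogram_mem_histograms _
  · funext x
    rw [selectedDensity_eq_sum (rowPairs_injective hj hb hkb hM), Fintype.sum_prod_type,
      Fintype.card_prod, Fintype.card_fin, Fintype.card_fin, ← Finset.mul_sum, Nat.cast_mul,
      mul_inv, mul_assoc]
    congr 1
    rw [Finset.mul_sum]
    refine Finset.sum_congr rfl fun i _ => ?_
    have hleft : ∀ m, ∏ j, binHistogram b (rowPairs j₀ j₁ hb hkb hM (i, m) (s (i, m)) j) (x j)
        = binHistogram b (β i m) (x j₁)
          * ∏ j ∈ Finset.univ.erase j₁, binHistogram b (base i j) (x j) := by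
      intro m
      rw [← Finset.mul_prod_erase _ _ (Finset.mem_univ j₁)]
      congr 1
      · simp [rowPairs, hβ]
      · refine Finset.prod_congr rfl fun j hj' => ?_
        rw [rowPairs, Function.update_of_ne (Finset.ne_of_mem_erase hj')]
    simp only [hleft]
    rw [← Finset.mul_prod_erase _ _ (Finset.mem_univ j₁), Function.update_self, ← Finset.sum_mul,
      ← mul_assoc]
    congr 1
    refine Finset.prod_congr rfl fun j hj' => ?_
    rw [Function.update_of_ne (Finset.ne_of_mem_erase hj')]

end Rows

lemma approxError_eq_zero {d b k : ℕ} {p : (Fin d → ℝ) → ℝ}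
    (hp : p ∈ multiViewHistograms d b k) : approxError d b k p = 0 := by
  refine le_antisymm ((iInf₂_le p hp).trans ?_) zero_le
  simp [l1Dist]

/-- With at most `k * b / 8` samples, no estimator that takes values in the multi-view histograms
reaches accuracy `1/8` with outer probability more than `1/2` at all of these histograms. -/
lemma half_le_iSup_sampleLaw {d b k n : ℕ} (hd : 2 ≤ d) (hk : 0 < k) (hkb : k ≤ b) (hb : 2 ≤ b)
    (hn : 8 * n ≤ b * k) {W : (Fin n → Fin d → ℝ) → (Fin d → ℝ) → ℝ}
    (hW : ∀ X, W X ∈ multiViewHistograms d b k) :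
    2⁻¹ ≤ ⨆ p : {p : (Fin d → ℝ) → ℝ // IsCubeDensity d p}, sampleLaw n p.1
      {X | l1Dist (W X) p.1 > 3 * approxError d b k p.1 + ENNReal.ofReal (1 / 8)} := by
  have hM : 2 * (b / 2) ≤ b := Nat.mul_div_le b 2
  have hM0 : 0 < b / 2 := by omega
  have hb0 : 0 < b := by omega
  have : Nonempty (Fin k × Fin (b / 2)) := ⟨(⟨0, hk⟩, ⟨0, hM0⟩)⟩
  have hj : (⟨0, by omega⟩ : Fin d) ≠ ⟨1, by omega⟩ := by simp
  have hinj := rowPairs_injective hj hb0 hkb hM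
  have hcard : 2 * n ≤ Fintype.card (Fin k × Fin (b / 2)) := by
    rw [Fintype.card_prod, Fintype.card_fin, Fintype.card_fin]
    -- Rounding down in `b / 2` costs at most a factor 2 because `b ≥ 2`; this is the source of the
    -- 8 in `hn`.
    have h4 : b ≤ 4 * (b / 2) := by omega
    nlinarith [Nat.mul_le_mul_left k h4]
  obtain ⟨s, hs⟩ := exists_half_le_sampleLaw hb0.ne' hinj hcard
    fun X => measurable_of_mem_multiViewHistograms (hW X)
  have happ := approxError_eq_zero
    (selectedDensity_rowPairs_mem_multiViewHistograms hj hb0 hkb hM hk hM0 s)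
  refine le_trans ?_ (le_iSup _ ⟨_, isCubeDensity_selectedDensity hb0.ne' hinj s⟩)
  simpa only [happ, mul_zero, zero_add] using hs

theorem theorem2p4 (d : ℕ) (hd : 2 ≤ d) (b k : ℕ → ℕ) (hk_pos : ∀ n, 1 ≤ k n)
    (hb : Tendsto b atTop atTop) (hk : Tendsto k atTop atTop) (hkb : ∀ n, k n ≤ b n)
    (hn : Tendsto (fun n : ℕ => (n : ℝ) / ((b n : ℝ) * (k n : ℝ))) atTop (𝓝 0)) :
    ¬ ∃ V : (n : ℕ) → (Fin n → Fin d → ℝ) → (Fin d → ℝ) → ℝ,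
      (∀ n X, V n X ∈ multiViewHistograms d (b n) (k n)) ∧
      ∀ ε : ℝ, 0 < ε →
        Tendsto
          (fun n : ℕ => ⨆ p : {p : (Fin d → ℝ) → ℝ // IsCubeDensity d p},
            sampleLaw n p.1
              {X | l1Dist (V n X) p.1 >
                3 * approxError d (b n) (k n) p.1 + ENNReal.ofReal ε})
          atTop (𝓝 0) := by
  rintro ⟨V, hV, hlim⟩
  have hsmall := (hlim (1 / 8) (by norm_num)).eventually_lt_const
    (show (0 : ℝ≥0∞) < 2⁻¹ by norm_num)
  -- This 1/8 bounds the sample size relative to `b * k`; the one in `hsmall` is the accuracy.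
  have hratio := hn.eventually_le_const (show (0 : ℝ) < 1 / 8 by norm_num)
  obtain ⟨n, hlt, hle, hb2⟩ := (hsmall.and (hratio.and (hb.eventually_ge_atTop 2))).exists
  refine absurd (half_le_iSup_sampleLaw hd (hk_pos n) (hkb n) hb2 ?_ (hV n)) (not_le.2 hlt)
  have hbk : (0 : ℝ) < (b n : ℝ) * (k n : ℝ) := by
    have h : 0 < b n * k n := Nat.mul_pos (by omega) (hk_pos n)
    exact_mod_cast h
  rw [div_le_iff₀ hbk] at hle
  have h : 8 * (n : ℝ) ≤ (b n : ℝ) * (k n : ℝ) := by linarith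
  exact_mod_cast h
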